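/- Let $d,p\ge 1$ be integers and let $f:\mathbb{R}^d\to[0,\infty)$ be a (Borel measurable) probability density. Write $G(t)=\{x\in\mathbb{R}^d: f(x)\ge t\}$, and let $\|\cdot\|$ be the Euclidean norm. Assume: (G) for every $t\in[l,u]$ the level set $G(t)$ is compact, nonempty and not convex; (A) $-\infty<l\le u<\sup f<\infty$; there are $\zeta>0$ and a bounded open set $U\subset\mathbb{R}^d$ such that $G(u+\zeta)$ is bounded, $\overline{G(l-\zeta)}\setminus \operatorname{int}G(u+\zeta)\subset U$ and $f\in C^p(U)$; and there are constants $m>0$ and $k$ with $\|\nabla f(x)\|\ge m$ and $\|\nabla f(x)-\nabla f(y)\|\le k\|x-y\|$ for all $x,y\in U$; (K) $K:\mathbb{R}^d\to\mathbb{R}$ is continuous with bounded support and finite total variation (that is, $\sup\int K\operatorname{div}\varphi<\infty$ over all compactly supported $C^1$ vector fields $\varphi$ with $\|\varphi\|\le 1$), and is a kernel of order at least $p$: $\int K=1$ and $\int z^\alpha K(z)\,dz=0$ for all multi-indices $\alpha$ with $1\le|\alpha|<p$; the bandwidths $h=h_n>0$ are of the exact order $(\log n/n)^{1/(d+2p)}$;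 (K') either $K\ge 0$, or $f$ is uniformly continuous on $\mathbb{R}^d\setminus G(l)$. Then there is a constant $M_0>0$ such that for every $M\ge M_0$ the following holds with $D_n=M(\log n/n)^{p/(d+2p)}$. Let $X_1,X_2,\dots$ be independent random vectors with density $f$, let $\mathcal{X}_n=\{X_1,\dots,X_n\}$, let $$f_n(x)=\frac{1}{nh^d}\sum_{i=1}^n K\Big(\frac{x-X_i}{h}\Big),\qquad \mathcal{X}_n^+(t)=\{X\in\mathcal{X}_n: f_n(X)\ge t+D_n\}.$$ Then for every $\epsilon>0$, $$\mathbb{P}\Big(\sup_{t\in[l,u]} d_H\big(G(t),\mathcal{X}_n^+(t)\big)\le\epsilon\ \text{ for all sufficiently large } n\Big)=1,$$ where $d_H$ is the Hausdorff distance, with $d_H(A,\emptyset)=\infty$ for $A\neq\emptyset$ (so the claim includes that all the sets $\mathcal{X}_n^+(t)$, $t\in[l,u]$, are nonempty for all large $n$). -/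

import Mathlib

open MeasureTheory ProbabilityTheory Filter Set

noncomputable section

namespace LevelSetEstimation

/-- `ℝ^d` with the Euclidean norm. -/
abbrev Space (d : ℕ) : Type := EuclideanSpace ℝ (Fin d)

/-- `f` is a (Borel measurable) probability density on `ℝ^d`. -/
structure IsDensity {d : ℕ} (f : Space d → ℝ) : Prop where
  measurable : Measurable f
  nonneg : ∀ x, 0 ≤ f x
  lintegral_eq_one : ∫⁻ x, ENNReal.ofReal (f x) = 1

/-- The probability distribution with density `f`. -/
def densityLaw {d : ℕ} (f : Space d → ℝ) : Measure (Space d) :=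
  volume.withDensity fun x => ENNReal.ofReal (f x)

/-- The level set `G(t) = {x : f(x) ≥ t}`. -/
def levelSet {d : ℕ} (f : Space d → ℝ) (t : ℝ) : Set (Space d) :=
  {x | t ≤ f x}

/-- The regularity assumption on the density `f` around the levels in `[l, u]`. -/
structure RegularLevels {d : ℕ} (f : Space d → ℝ) (p : ℕ) (l u : ℝ) : Prop where
  le : l ≤ u
  bddAbove : BddAbove (range f)
  lt_sup : u < ⨆ x, f x
  smooth : ∃ (ζ : ℝ) (U : Set (Space d)) (m k : ℝ),
    0 < ζ ∧ IsOpen U ∧ Bornology.IsBounded U ∧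
    Bornology.IsBounded (levelSet f (u + ζ)) ∧
    closure (levelSet f (l - ζ)) \ interior (levelSet f (u + ζ)) ⊆ U ∧
    ContDiffOn ℝ p f U ∧
    0 < m ∧ (∀ x ∈ U, m ≤ ‖gradient f x‖) ∧
    (∀ x ∈ U, ∀ y ∈ U, ‖gradient f x - gradient f y‖ ≤ k * ‖x - y‖)

/-- The divergence `∑ᵢ ∂ᵢ φᵢ` of a vector field. -/
def divergence {d : ℕ} (φ : Space d → Space d) (x : Space d) : ℝ :=
  ∑ i, fderiv ℝ φ x (EuclideanSpace.single i 1) i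

/-- Finite total variation on `ℝ^d`: the integrals `∫ K div φ`, over all `C¹` vector fields `φ`
with compact support and `|φ| ≤ 1`, are bounded (used for continuous `K` with bounded support). -/
def HasFiniteVariation {d : ℕ} (K : Space d → ℝ) : Prop :=
  ∃ V : ℝ, ∀ φ : Space d → Space d, ContDiff ℝ 1 φ → HasCompactSupport φ →
    (∀ x, ‖φ x‖ ≤ 1) → ∫ x, K x * divergence φ x ≤ V

/-- `K` integrates to one and its moments of total degree `1, …, p - 1` vanish: a kernel of order
at least `p` (for kernels that are continuous with bounded support, so that all moments exist). -/
def HasOrderAtLeast {d : ℕ} (K : Space d → ℝ) (p : ℕ) : Prop :=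
  ∫ z, K z = 1 ∧
    ∀ α : Fin d → ℕ, 0 < ∑ i, α i → ∑ i, α i < p → ∫ z, (∏ i, z i ^ α i) * K z = 0

/-- A continuous kernel of order at least `p` with bounded support and finite variation. -/
structure IsAdmissibleKernel {d : ℕ} (K : Space d → ℝ) (p : ℕ) : Prop where
  continuous : Continuous K
  order : HasOrderAtLeast K p
  bounded_support : Bornology.IsBounded (Function.support K)
  finite_variation : HasFiniteVariation K

/-- The bandwidth sequence `h` is positive and of the exact order `(log n / n)^{1/(d+2p)}`. -/
def IsAdmissibleBandwidth (d p : ℕ) (h : ℕ → ℝ) : Prop :=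
  (∀ᶠ n in atTop, 0 < h n) ∧
    Asymptotics.IsTheta atTop h
      (fun n : ℕ => (Real.log n / n) ^ ((1 : ℝ) / ((d : ℝ) + 2 * (p : ℝ))))

/-- The sequence `D_n = M (log n / n)^{p/(d+2p)}`. -/
def thresholdShift (d p : ℕ) (M : ℝ) (n : ℕ) : ℝ :=
  M * (Real.log n / n) ^ ((p : ℝ) / ((d : ℝ) + 2 * (p : ℝ)))

/-- The kernel density estimator `x ↦ (n h^d)⁻¹ ∑_{i < n} K((x - x_i) / h)` built from the first
`n` points of the sequence `x_0, x_1, …`. -/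
def kernelEstimator {d : ℕ} (K : Space d → ℝ) (h : ℝ) (n : ℕ) (pts : ℕ → Space d)
    (x : Space d) : ℝ :=
  ((n : ℝ) * h ^ d)⁻¹ * ∑ i ∈ Finset.range n, K (h⁻¹ • (x - pts i))

/-- The subsample of those among the first `n` points at which the kernel density estimator
is at least `t + D`. -/
def plusSample {d : ℕ} (K : Space d → ℝ) (h : ℝ) (D : ℝ) (n : ℕ) (pts : ℕ → Space d) (t : ℝ) :
    Set (Space d) :=
  {x | (∃ i < n, pts i = x) ∧ t + D ≤ kernelEstimator K h n pts x}

end LevelSetEstimation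

end

/-!
Strong consistency of the estimated level sets rests on two separations at the levels of a band
without local maxima: from every point of `G(t)` one reaches, within distance `ε`, an open set on
which `f` exceeds `t` by a fixed amount, and a point with no point of `G(t)` within distance `ε`
has density below `t` by a fixed amount. By compactness finitely many open sets serve all `t` at
once, and almost surely the sample hits each of them. At the sample points the kernel estimator is
uniformly close to its mean, the convolution `K_h * f`, by an exponential inequality and the
Borel–Cantelli lemma. At the finitely many sample points chosen in `G(t)` the mean converges to
`f` by Lebesgue's differentiation theorem; far from `G(t)` it stays below `t`, either because
`K ≥ 0` averages values below `t` or because `f` is uniformly continuous there.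
-/

namespace LevelSetEstimation

section Tail

variable {Ω E F ι : Type*} [MeasurableSpace Ω] [MeasurableSpace E] [MeasurableSpace F]
  {P : Measure Ω} [IsProbabilityMeasure P] {B V c : ℝ}

lemma mgf_le_exp_integral_add_integral_sq {Y : Ω → ℝ} (hY : AEMeasurable Y P)
    (hB : ∀ ω, |Y ω| ≤ B) (hc : 0 ≤ c) (hcB : c * B ≤ 1) :
    mgf Y P c ≤ Real.exp (c * ∫ ω, Y ω ∂P + c ^ 2 * ∫ ω, Y ω ^ 2 ∂P) := by
  have hYi : Integrable Y P := .of_bound hY.aestronglyMeasurable B (.of_forall hB)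
  have hY2i : Integrable (fun ω => Y ω ^ 2) P := by
    simpa only [sq] using hYi.bdd_mul hY.aestronglyMeasurable (.of_forall hB)
  have hlin : Integrable (fun ω => 1 + c * Y ω) P := (integrable_const 1).add (hYi.const_mul c)
  have hcY : ∀ ω, |c * Y ω| ≤ 1 := fun ω => by
    rw [abs_mul, abs_of_nonneg hc]
    exact (mul_le_mul_of_nonneg_left (hB ω) hc).trans hcB
  calc mgf Y P c ≤ ∫ ω, (1 + c * Y ω + c ^ 2 * Y ω ^ 2) ∂P := by
        refine integral_mono_of_nonneg (.of_forall fun ω => (Real.exp_pos _).le)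
          (hlin.add (hY2i.const_mul _)) (.of_forall fun ω => ?_)
        have := (abs_le.1 (Real.abs_exp_sub_one_sub_id_le (hcY ω))).2
        simp only [mul_pow] at this ⊢
        linarith
    _ = c * ∫ ω, Y ω ∂P + c ^ 2 * ∫ ω, Y ω ^ 2 ∂P + 1 := by
        rw [integral_add hlin (hY2i.const_mul _), integral_add (integrable_const 1)
          (hYi.const_mul c), integral_const_mul, integral_const_mul, integral_const,
          probReal_univ, one_smul]
        ring
    _ ≤ Real.exp (c * ∫ ω, Y ω ∂P + c ^ 2 * ∫ ω, Y ω ^ 2 ∂P) := Real.add_one_le_exp _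

lemma measureReal_sum_sub_integral_ge_le {Y : ι → Ω → ℝ} (hY : ∀ j, AEMeasurable (Y j) P)
    (hind : iIndepFun Y P) (hB : ∀ j ω, |Y j ω| ≤ B) (hV : ∀ j, ∫ ω, Y j ω ^ 2 ∂P ≤ V)
    (hc : 0 ≤ c) (hcB : c * B ≤ 1) (S : Finset ι) (s : ℝ) :
    P.real {ω | s ≤ ∑ j ∈ S, (Y j ω - ∫ ω', Y j ω' ∂P)}
      ≤ Real.exp (-(c * s) + S.card * (c ^ 2 * V)) := by
  set m := ∑ j ∈ S, ∫ ω, Y j ω ∂P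
  have hsum : AEMeasurable (∑ j ∈ S, Y j) P := Finset.aemeasurable_sum S fun j _ => hY j
  have hexp_integrable : Integrable (fun ω => Real.exp (c * (∑ j ∈ S, Y j) ω)) P := by
    refine .of_bound (hsum.const_mul c).exp.aestronglyMeasurable
      (Real.exp (c * (S.card * B))) (.of_forall fun ω => ?_)
    rw [Real.norm_eq_abs, Real.abs_exp]
    gcongr
    rw [Finset.sum_apply, ← nsmul_eq_mul]
    exact Finset.sum_le_card_nsmul _ _ _ fun j _ => (le_abs_self _).trans (hB j ω)
  have hmgf : mgf (∑ j ∈ S, Y j) P c ≤ Real.exp (c * m + S.card * (c ^ 2 * V)) := by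
    rw [hind.mgf_sum₀ hY, Finset.mul_sum, ← nsmul_eq_mul, ← Finset.sum_const,
      ← Finset.sum_add_distrib, Real.exp_sum]
    gcongr with j
    · exact fun j _ => mgf_nonneg
    · refine (mgf_le_exp_integral_add_integral_sq (hY j) (hB j) hc hcB).trans ?_
      gcongr
      exact hV j
  calc P.real {ω | s ≤ ∑ j ∈ S, (Y j ω - ∫ ω', Y j ω' ∂P)}
      = P.real {ω | s + m ≤ (∑ j ∈ S, Y j) ω} := by
        simp only [Finset.sum_sub_distrib, le_sub_iff_add_le, Finset.sum_apply, m]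
    _ ≤ Real.exp (-c * (s + m)) * mgf (∑ j ∈ S, Y j) P c :=
        measure_ge_le_exp_mul_mgf _ hc hexp_integrable
    _ ≤ Real.exp (-c * (s + m)) * Real.exp (c * m + S.card * (c ^ 2 * V)) := by gcongr
    _ = Real.exp (-(c * s) + S.card * (c ^ 2 * V)) := by
        rw [← Real.exp_add]
        ring_nf

lemma measureReal_abs_sum_sub_integral_ge_le {Y : ι → Ω → ℝ} (hY : ∀ j, AEMeasurable (Y j) P)
    (hind : iIndepFun Y P) (hB : ∀ j ω, |Y j ω| ≤ B) (hV : ∀ j, ∫ ω, Y j ω ^ 2 ∂P ≤ V)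
    (hc : 0 ≤ c) (hcB : c * B ≤ 1) (S : Finset ι) (s : ℝ) :
    P.real {ω | s ≤ |∑ j ∈ S, (Y j ω - ∫ ω', Y j ω' ∂P)|}
      ≤ 2 * Real.exp (-(c * s) + S.card * (c ^ 2 * V)) := by
  have hupper := measureReal_sum_sub_integral_ge_le hY hind hB hV hc hcB S s
  have hlower := measureReal_sum_sub_integral_ge_le (Y := fun j ω => -Y j ω)
    (fun j => (hY j).neg) (hind.comp (fun _ => Neg.neg) fun _ => measurable_neg)
    (by simpa using hB) (by simpa using hV) hc hcB S s
  calc P.real {ω | s ≤ |∑ j ∈ S, (Y j ω - ∫ ω', Y j ω' ∂P)|}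
      ≤ P.real ({ω | s ≤ ∑ j ∈ S, (Y j ω - ∫ ω', Y j ω' ∂P)} ∪
          {ω | s ≤ ∑ j ∈ S, (-Y j ω - ∫ ω', -Y j ω' ∂P)}) := by
        refine measureReal_mono fun ω hω => ?_
        have hneg : ∑ j ∈ S, (-Y j ω - ∫ ω', -Y j ω' ∂P)
            = -∑ j ∈ S, (Y j ω - ∫ ω', Y j ω' ∂P) := by
          simp only [integral_neg, ← Finset.sum_neg_distrib, neg_sub_neg, neg_sub]
        simpa only [mem_union, mem_ofPred_eq, hneg] using le_abs.1 hω
    _ ≤ 2 * Real.exp (-(c * s) + S.card * (c ^ 2 * V)) := by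
        linarith [measureReal_union_le (μ := P)
          {ω | s ≤ ∑ j ∈ S, (Y j ω - ∫ ω', Y j ω' ∂P)}
          {ω | s ≤ ∑ j ∈ S, (-Y j ω - ∫ ω', -Y j ω' ∂P)}]

lemma measure_prodMk_mem_le_of_indepFun {X : Ω → E} {T : Ω → F} (hX : AEMeasurable X P)
    (hT : AEMeasurable T P) (hXT : IndepFun X T P) {W : Set (E × F)} (hW : MeasurableSet W)
    {a : ENNReal} (ha : ∀ x, P {ω | (x, T ω) ∈ W} ≤ a) : P {ω | (X ω, T ω) ∈ W} ≤ a := by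
  have := Measure.isProbabilityMeasure_map hX
  have := Measure.isProbabilityMeasure_map hT
  calc P {ω | (X ω, T ω) ∈ W} = (P.map X).prod (P.map T) W := by
        rw [← (indepFun_iff_map_prod_eq_prod_map_map hX hT).1 hXT,
          Measure.map_apply_of_aemeasurable (hX.prodMk hT) hW]
        rfl
    _ = ∫⁻ x, P {ω | (x, T ω) ∈ W} ∂P.map X := by
        rw [Measure.prod_apply hW]
        refine lintegral_congr fun x => ?_
        rw [Measure.map_apply_of_aemeasurable hT (measurable_prodMk_left hW)]
        rfl
    _ ≤ ∫⁻ _, a ∂P.map X := lintegral_mono ha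
    _ = a := by rw [lintegral_const, measure_univ, mul_one]

variable {ν : Measure E} {X : ι → Ω → E}

lemma measureReal_abs_sum_sub_integral_sample_ge_le (hX : ∀ i, HasLaw (X i) ν P)
    (hind : iIndepFun X P) {φ : E → E → ℝ} (hφ : Measurable (Function.uncurry φ))
    (hB : ∀ x y, |φ x y| ≤ B) (hV : ∀ x, ∫ y, φ x y ^ 2 ∂ν ≤ V) (hc : 0 ≤ c) (hcB : c * B ≤ 1)
    {i : ι} {S : Finset ι} (hi : i ∉ S) (s : ℝ) :
    P.real {ω | s ≤ |∑ j ∈ S, (φ (X i ω) (X j ω) - ∫ y, φ (X i ω) y ∂ν)|}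
      ≤ 2 * Real.exp (-(c * s) + S.card * (c ^ 2 * V)) := by
  have : IsProbabilityMeasure ν := (hX i).isProbabilityMeasure_iff.1 ‹_›
  have hφx : ∀ x, Measurable (φ x) := fun x => hφ.of_uncurry_left
  let W : Set (E × (S → E)) := {q | s ≤ |∑ j, (φ q.1 (q.2 j) - ∫ y, φ q.1 y ∂ν)|}
  have hW : MeasurableSet W := by
    have hmean : Measurable fun x => ∫ y, φ x y ∂ν :=
      hφ.stronglyMeasurable.integral_prod_right.measurable
    refine measurableSet_le measurable_const (continuous_abs.measurable.comp ?_)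
    refine Finset.measurable_sum _ fun j _ => .sub ?_ (hmean.comp measurable_fst)
    exact hφ.comp (g := Function.uncurry φ) (f := fun q : E × (S → E) => (q.1, q.2 j))
      (measurable_fst.prodMk ((measurable_pi_apply j).comp measurable_snd))
  have hmemW : ∀ x ω, (x, fun j : S => X j ω) ∈ W ↔
      s ≤ |∑ j ∈ S, (φ x (X j ω) - ∫ y, φ x y ∂ν)| := fun x ω => by
    simp only [W, mem_ofPred_eq, Finset.sum_coe_sort S fun j => φ x (X j ω) - ∫ y, φ x y ∂ν]
  have hXS : IndepFun (X i) (fun ω (j : S) => X j ω) P :=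
    (hind.indepFun_finset₀ {i} S (Finset.disjoint_singleton_left.2 hi)
      fun j => (hX j).aemeasurable).comp
      (measurable_pi_apply (⟨i, Finset.mem_singleton_self i⟩ : ({i} : Finset ι))) measurable_id
  have hfixed : ∀ x, P {ω | (x, fun j : S => X j ω) ∈ W}
      ≤ ENNReal.ofReal (2 * Real.exp (-(c * s) + S.card * (c ^ 2 * V))) := fun x => by
    have hmean : ∀ j, ∫ ω, φ x (X j ω) ∂P = ∫ y, φ x y ∂ν := fun j =>
      (hX j).integral_comp (hφx x).aestronglyMeasurable
    have hsq : ∀ j, ∫ ω, φ x (X j ω) ^ 2 ∂P ≤ V := fun j =>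
      ((hX j).integral_comp ((hφx x).pow_const 2).aestronglyMeasurable).trans_le (hV x)
    have htail := measureReal_abs_sum_sub_integral_ge_le
      (fun j => (hφx x).comp_aemeasurable (hX j).aemeasurable)
      (hind.comp (fun _ => φ x) fun _ => hφx x) (fun j ω => hB x (X j ω)) hsq hc hcB S s
    simp only [Function.comp_apply, hmean] at htail
    simp only [hmemW]
    rw [← ofReal_measureReal]
    exact ENNReal.ofReal_le_ofReal htail
  simp only [← hmemW]
  exact ENNReal.toReal_le_of_le_ofReal (by positivity) <|
    measure_prodMk_mem_le_of_indepFun (T := fun ω (j : S) => X j ω) (hX i).aemeasurable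
      (aemeasurable_pi_lambda _ fun j => (hX j).aemeasurable) hXS hW hfixed

end Tail

lemma ae_exists_mem_of_measure_ne_zero {Ω E : Type*} [MeasurableSpace Ω] [MeasurableSpace E]
    {P : Measure Ω} [IsProbabilityMeasure P] {ν : Measure E} {X : ℕ → Ω → E}
    (hX : ∀ i, HasLaw (X i) ν P) (hind : iIndepFun X P) {V : Set E} (hV : MeasurableSet V)
    (hνV : ν V ≠ 0) : ∀ᵐ ω ∂P, ∃ i, X i ω ∈ V := by
  have : IsProbabilityMeasure ν := (hX 0).isProbabilityMeasure_iff.1 ‹_›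
  have hlt : ν Vᶜ < 1 := by
    rw [prob_compl_eq_one_sub hV]
    exact ENNReal.sub_lt_self ENNReal.one_ne_top one_ne_zero hνV
  have hle : ∀ n : ℕ, P {ω | ¬ ∃ i, X i ω ∈ V} ≤ ν Vᶜ ^ n := fun n => by
    calc P {ω | ¬ ∃ i, X i ω ∈ V} ≤ P (⋂ i ∈ Finset.range n, X i ⁻¹' Vᶜ) :=
          measure_mono fun ω hω => mem_iInter₂.2 fun i _ => not_exists.1 hω i
      _ = ∏ i ∈ Finset.range n, P (X i ⁻¹' Vᶜ) :=
          hind.measure_inter_preimage_eq_mul _ fun _ _ => hV.compl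
      _ = ∏ _i ∈ Finset.range n, ν Vᶜ :=
          Finset.prod_congr rfl fun i _ => (hX i).measure_eq (p := (· ∈ Vᶜ)) hV.compl
      _ = ν Vᶜ ^ n := by rw [Finset.prod_const, Finset.card_range]
  exact le_antisymm
    (ge_of_tendsto' (ENNReal.tendsto_pow_atTop_nhds_zero_of_lt_one hlt) hle) zero_le

section Band

variable {E : Type*} [PseudoMetricSpace E] {f : E → ℝ} {C : Set E} {a b l u ε r : ℝ} {x : E}

lemma exists_forall_exists_dist_le_add_le (hC : IsCompact C) (hcont : ∀ x ∈ C, ContinuousAt f x)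
    (hmax : ∀ x ∈ C, ¬ IsLocalMax f x) (hε : 0 < ε) :
    ∃ c > 0, ∀ x ∈ C, ∃ y, dist x y ≤ ε ∧ f x + c ≤ f y := by
  refine hC.induction_on (p := fun S => ∃ c > 0, ∀ x ∈ S, ∃ y, dist x y ≤ ε ∧ f x + c ≤ f y)
    ⟨1, one_pos, fun x hx => hx.elim⟩ ?_ ?_ fun x hx => ?_
  · rintro S T hST ⟨c, hc, hT⟩
    exact ⟨c, hc, fun x hx => hT x (hST hx)⟩
  · rintro S T ⟨c, hc, hS⟩ ⟨c', hc', hT⟩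
    refine ⟨min c c', lt_min hc hc', ?_⟩
    rintro x (hx | hx)
    · obtain ⟨y, hy, hxy⟩ := hS x hx
      exact ⟨y, hy, by linarith [min_le_left c c']⟩
    · obtain ⟨y, hy, hxy⟩ := hT x hx
      exact ⟨y, hy, by linarith [min_le_right c c']⟩
  · have hup : ∃ᶠ y in nhds x, f x < f y := by
      simpa only [IsLocalMax, IsMaxFilter, not_eventually, not_le] using hmax x hx
    obtain ⟨y, hxy, hy⟩ :=
      (hup.and_eventually (Metric.ball_mem_nhds x (half_pos hε))).exists
    refine ⟨_, mem_nhdsWithin_of_mem_nhds (inter_mem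
      (Metric.ball_mem_nhds x (half_pos hε))
      ((hcont x hx).eventually_lt_const (by linarith : f x < f x + (f y - f x) / 2))),
      (f y - f x) / 2, by linarith, fun z hz => ⟨y, ?_, ?_⟩⟩
    · linarith [Metric.mem_ball.1 hz.1, Metric.mem_ball.1 hy, dist_triangle_right z y x]
    · have : f z < f x + (f y - f x) / 2 := hz.2
      linarith

/-- The closed band of points at which `f` lies between the levels `a` and `b`, up to boundary
points: outside of it, every point is either exterior to `{a ≤ f}` or interior to `{b ≤ f}`. -/
def levelBand (f : E → ℝ) (a b : ℝ) : Set E :=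
  closure {x | a ≤ f x} \ interior {x | b ≤ f x}

/-- Regularity of `f` between the levels `a` and `b`; the absence of local maxima stands in for a
nonvanishing gradient. -/
structure IsRegularBand (f : E → ℝ) (a b : ℝ) : Prop where
  isBounded : Bornology.IsBounded {x | a ≤ f x}
  continuousAt : ∀ x ∈ levelBand f a b, ContinuousAt f x
  not_isLocalMax : ∀ x ∈ levelBand f a b, ¬ IsLocalMax f x

lemma eventually_le_of_notMem_levelBand (hx : x ∉ levelBand f a b) (hax : a ≤ f x) :
    ∀ᶠ y in nhds x, b ≤ f y := by
  by_contra h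
  exact hx ⟨subset_closure hax, fun hmem => h (mem_interior_iff_mem_nhds.1 hmem)⟩

lemma lt_of_notMem_levelBand (hx : x ∉ levelBand f a b) (hxb : f x < b) : f x < a := by
  by_contra! hax
  exact (eventually_le_of_notMem_levelBand hx hax).self_of_nhds.not_gt hxb

namespace IsRegularBand

lemma eventually_lt (hf : IsRegularBand f a b) (hax : a ≤ f x) (hrx : r < f x) (hrb : r < b) :
    ∀ᶠ z in nhds x, r < f z := by
  by_cases hx : x ∈ levelBand f a b
  · exact (hf.continuousAt x hx).eventually_const_lt hrx
  · filter_upwards [eventually_le_of_notMem_levelBand hx hax] with z hz using hrb.trans_le hz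

variable [ProperSpace E]

lemma isCompact_levelBand (hf : IsRegularBand f a b) : IsCompact (levelBand f a b) :=
  Metric.isCompact_of_isClosed_isBounded (isClosed_closure.sdiff isOpen_interior)
    (hf.isBounded.closure.subset sdiff_subset)

lemma exists_forall_exists_dist_le (hf : IsRegularBand f a b) (hε : 0 < ε) :
    ∃ c > 0, ∀ x, a ≤ f x → ∃ y, dist x y ≤ ε ∧ min (f x + c) b ≤ f y := by
  obtain ⟨c, hc, hasc⟩ := exists_forall_exists_dist_le_add_le hf.isCompact_levelBand
    hf.continuousAt hf.not_isLocalMax hε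
  refine ⟨c, hc, fun x hax => ?_⟩
  by_cases hx : x ∈ levelBand f a b
  · obtain ⟨y, hxy, hy⟩ := hasc x hx
    exact ⟨y, hxy, min_le_of_left_le hy⟩
  · exact ⟨x, by simpa using hε.le,
      min_le_of_right_le (eventually_le_of_notMem_levelBand hx hax).self_of_nhds⟩

lemma exists_forall_le_sub (hf : IsRegularBand f a b) (hal : a < l) (hub : u < b) (hε : 0 < ε) :
    ∃ c > 0, ∀ t ∈ Icc l u, ∀ x, (∀ y, dist x y ≤ ε → f y < t) → f x ≤ t - c := by
  obtain ⟨c, hc, hasc⟩ := hf.exists_forall_exists_dist_le hε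
  refine ⟨min c (l - a), lt_min hc (sub_pos.2 hal), fun t ht x hx => ?_⟩
  rcases lt_or_ge (f x) a with hxa | hax
  · linarith [min_le_right c (l - a), ht.1]
  · obtain ⟨y, hxy, hy⟩ := hasc x hax
    have : f x + c < t :=
      (min_lt_iff.1 (hy.trans_lt (hx y hxy))).resolve_right (ht.2.trans hub.le).not_gt
    linarith [min_le_left c (l - a)]

lemma exists_forall_eventually_lt (hf : IsRegularBand f a b) (hal : a < l) (hub : u < b)
    (hε : 0 < ε) :
    ∃ c > 0, ∀ t ∈ Icc l u, ∀ x, t ≤ f x → ∃ y, dist x y ≤ ε ∧ ∀ᶠ z in nhds y, t + c < f z := by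
  obtain ⟨c, hc, hasc⟩ := hf.exists_forall_exists_dist_le hε
  have hc' : 0 < min c (b - u) := lt_min hc (sub_pos.2 hub)
  refine ⟨min c (b - u) / 2, half_pos hc', fun t ht x hx => ?_⟩
  obtain ⟨y, hxy, hy⟩ := hasc x (hal.le.trans (ht.1.trans hx))
  have hty : t + min c (b - u) ≤ f y := by
    refine le_trans (le_min ?_ ?_) hy
    · linarith [min_le_left c (b - u)]
    · linarith [min_le_right c (b - u), ht.2]
  exact ⟨y, hxy, hf.eventually_lt (by linarith [ht.1]) (by linarith)
    (by linarith [min_le_right c (b - u), ht.2])⟩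

lemma totallyBounded_prod_Icc (hf : IsRegularBand f a b) (hal : a ≤ l) :
    TotallyBounded {q : E × ℝ | q.2 ∈ Icc l u ∧ q.2 ≤ f q.1} := by
  have hcompact : IsCompact (closure {x | a ≤ f x} ×ˢ Icc l u) :=
    (Metric.isCompact_of_isClosed_isBounded isClosed_closure hf.isBounded.closure).prod
      isCompact_Icc
  refine hcompact.totallyBounded.subset fun q hq => ?_
  exact ⟨subset_closure (hal.trans (hq.1.1.trans hq.2)), hq.1⟩

lemma exists_finite_isOpen (hf : IsRegularBand f a b) (hal : a < l) (hub : u < b) (hε : 0 < ε) :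
    ∃ c > 0, ∃ 𝒱 : Set (Set E), 𝒱.Finite ∧
      (∀ V ∈ 𝒱, IsOpen V ∧ V.Nonempty ∧ ∀ z ∈ V, l ≤ f z) ∧
      ∀ t ∈ Icc l u, ∀ x, t ≤ f x → ∃ V ∈ 𝒱, ∀ z ∈ V, dist x z ≤ ε ∧ t + c ≤ f z := by
  obtain ⟨c, hc, hasc⟩ := hf.exists_forall_eventually_lt hal hub (by positivity : 0 < ε / 3)
  obtain ⟨N, hNT, hN, hcover⟩ := Metric.finite_approx_of_totallyBounded
    (hf.totallyBounded_prod_Icc (u := u) hal.le) (min (ε / 3) (c / 2)) (by positivity)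
  have hnear : ∀ q ∈ N, ∃ V : Set E, IsOpen V ∧ V.Nonempty ∧
      ∀ z ∈ V, dist q.1 z ≤ ε / 3 + ε / 3 ∧ q.2 + c < f z := fun q hq => by
    obtain ⟨y, hxy, hy⟩ := hasc q.2 (hNT hq).1 q.1 (hNT hq).2
    obtain ⟨W, hW, hWo, hyW⟩ := mem_nhds_iff.1 hy
    refine ⟨W ∩ Metric.ball y (ε / 3), hWo.inter Metric.isOpen_ball,
      ⟨y, hyW, Metric.mem_ball_self (by positivity)⟩, fun z hz => ⟨?_, hW hz.1⟩⟩
    exact (dist_triangle q.1 y z).trans (add_le_add hxy (Metric.mem_ball'.1 hz.2).le)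
  choose! V hVo hVne hVnear using hnear
  refine ⟨c / 2, half_pos hc, V '' N, hN.image V, forall_mem_image.2 fun q hq =>
    ⟨hVo q hq, hVne q hq, fun z hz => ?_⟩, fun t ht x hx => ?_⟩
  · linarith [(hVnear q hq z hz).2, (hNT hq).1.1]
  have hxt : (x, t) ∈ {q : E × ℝ | q.2 ∈ Icc l u ∧ q.2 ≤ f q.1} := ⟨ht, hx⟩
  obtain ⟨q, hq, hxq⟩ := mem_iUnion₂.1 (hcover hxt)
  rw [Metric.mem_ball, Prod.dist_eq, max_lt_iff, lt_min_iff, lt_min_iff, Real.dist_eq] at hxq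
  obtain ⟨⟨hxq, -⟩, -, htq⟩ := hxq
  refine ⟨V q, mem_image_of_mem V hq, fun z hz => ?_⟩
  obtain ⟨hqz, hfz⟩ := hVnear q hq z hz
  exact ⟨by linarith [dist_triangle x q.1 z], by linarith [(abs_lt.1 htq).2]⟩

lemma uniformContinuousOn_compl (hf : IsRegularBand f a b) (hal : a ≤ l) (hub : u ≤ b)
    (huc : UniformContinuousOn f {x | l ≤ f x}ᶜ) : UniformContinuousOn f {x | u ≤ f x}ᶜ := by
  rw [Metric.uniformContinuousOn_iff] at huc ⊢
  intro ε hε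
  obtain ⟨r₁, hr₁, hlow⟩ := huc ε hε
  obtain ⟨r₂, hr₂, hband⟩ := Metric.mem_uniformity_dist.1
    (hf.isCompact_levelBand.uniformContinuousAt_of_continuousAt f hf.continuousAt
      (Metric.dist_mem_uniformity hε))
  have hbelow : ∀ x ∈ {x | u ≤ f x}ᶜ, x ∉ levelBand f a b → x ∈ {x | l ≤ f x}ᶜ :=
    fun x (hx : ¬ u ≤ f x) hxband => not_le.2 <|
      (lt_of_notMem_levelBand hxband ((not_le.1 hx).trans_le hub)).trans_le hal
  refine ⟨min r₁ r₂, lt_min hr₁ hr₂, fun x hx y hy hxy => ?_⟩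
  by_cases hxband : x ∈ levelBand f a b
  · exact hband (hxy.trans_le (min_le_right _ _)) hxband
  by_cases hyband : y ∈ levelBand f a b
  · rw [dist_comm] at hxy ⊢
    exact hband (hxy.trans_le (min_le_right _ _)) hyband
  · exact hlow x (hbelow x hx hxband) y (hbelow y hy hyband) (hxy.trans_le (min_le_left _ _))

end IsRegularBand

end Band

lemma not_isLocalMax_of_gradient_ne_zero {F : Type*} [NormedAddCommGroup F]
    [InnerProductSpace ℝ F] [CompleteSpace F] {f : F → ℝ} {x : F} (hx : gradient f x ≠ 0) :
    ¬ IsLocalMax f x := fun hmax => hx <| by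
  rw [gradient, hmax.fderiv_eq_zero, map_zero]

lemma continuousAt_of_gradient_ne_zero {F : Type*} [NormedAddCommGroup F]
    [InnerProductSpace ℝ F] [CompleteSpace F] {f : F → ℝ} {x : F} (hx : gradient f x ≠ 0) :
    ContinuousAt f x :=
  (not_imp_comm.1 gradient_eq_zero_of_not_differentiableAt hx).continuousAt

lemma RegularLevels.exists_isRegularBand {d p : ℕ} {f : Space d → ℝ} {l u : ℝ}
    (hA : RegularLevels f p l u) : ∃ ζ > 0, IsRegularBand f (l - ζ) (u + ζ) := by
  obtain ⟨ζ, U, m, k, hζ, -, hUb, hub, hband, -, hm, hgrad, -⟩ := hA.smooth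
  have hgrad0 : ∀ x ∈ levelBand f (l - ζ) (u + ζ), gradient f x ≠ 0 := fun x hx =>
    norm_pos_iff.1 (hm.trans_le (hgrad x (hband hx)))
  refine ⟨ζ, hζ, (hUb.union hub).subset fun x hx => ?_,
    fun x hx => continuousAt_of_gradient_ne_zero (hgrad0 x hx),
    fun x hx => not_isLocalMax_of_gradient_ne_zero (hgrad0 x hx)⟩
  by_cases hxband : x ∈ levelBand f (l - ζ) (u + ζ)
  · exact .inl (hband hxband)
  · exact .inr (eventually_le_of_notMem_levelBand hxband hx).self_of_nhds

section Density

variable {d : ℕ} {f : Space d → ℝ} {t : ℝ} {x : Space d}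

namespace IsDensity

lemma integrable (hf : IsDensity f) : Integrable f :=
  (lintegral_ofReal_ne_top_iff_integrable hf.measurable.aestronglyMeasurable
    (.of_forall hf.nonneg)).1 (by simp [hf.lintegral_eq_one])

lemma isProbabilityMeasure_densityLaw (hf : IsDensity f) : IsProbabilityMeasure (densityLaw f) :=
  ⟨by simp [densityLaw, hf.lintegral_eq_one]⟩

lemma integral_densityLaw (hf : IsDensity f) (g : Space d → ℝ) :
    ∫ y, g y ∂densityLaw f = ∫ y, g y * f y := by
  rw [densityLaw, integral_withDensity_eq_integral_toReal_smul
    hf.measurable.ennreal_ofReal (.of_forall fun _ => ENNReal.ofReal_lt_top)]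
  refine integral_congr_ae (.of_forall fun y => ?_)
  simp only [ENNReal.toReal_ofReal (hf.nonneg y), smul_eq_mul, mul_comm]

lemma densityLaw_ne_zero (hf : IsDensity f) {V : Set (Space d)} (hV : IsOpen V)
    (hne : V.Nonempty) (hpos : ∀ x ∈ V, 0 < f x) : densityLaw f V ≠ 0 := by
  have hsub : V ⊆ {x | ENNReal.ofReal (f x) ≠ 0} :=
    fun x hx => (ENNReal.ofReal_pos.2 (hpos x hx)).ne'
  rw [densityLaw, Ne, withDensity_apply_eq_zero hf.measurable.ennreal_ofReal,
    inter_eq_right.2 hsub]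
  exact hV.measure_ne_zero volume hne

lemma pos_of_isBounded_levelSet (hf : IsDensity f) (ht : Bornology.IsBounded (levelSet f t))
    (hx : t ≤ f x) : 0 < f x := by
  refine (hf.nonneg x).lt_of_ne' fun hfx => ?_
  have huniv : levelSet f t = univ :=
    eq_univ_of_forall fun y => (hx.trans_eq hfx).trans (hf.nonneg y)
  have hsub : Subsingleton (Space d) := by
    by_contra! hnontriv
    exact NormedSpace.unbounded_univ ℝ (Space d) (huniv ▸ ht)
  refine zero_ne_one (hf.lintegral_eq_one.symm.trans ?_).symm
  simp [fun y => congrArg f (hsub.elim y x), hfx]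

end IsDensity

lemma ae_forall_isOpen_exists_mem (hf : IsDensity f) {Ω : Type*} [MeasurableSpace Ω]
    {P : Measure Ω} [IsProbabilityMeasure P] {X : ℕ → Ω → Space d}
    (hX : ∀ i, HasLaw (X i) (densityLaw f) P) (hind : iIndepFun X P) :
    ∀ᵐ ω ∂P, ∀ V : Set (Space d), IsOpen V → V.Nonempty → (∀ x ∈ V, 0 < f x) →
      ∃ i, X i ω ∈ V := by
  have hbasis : ∀ᵐ ω ∂P, ∀ V ∈ TopologicalSpace.countableBasis (Space d),
      (V.Nonempty ∧ ∀ x ∈ V, 0 < f x) → ∃ i, X i ω ∈ V := by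
    refine (ae_ball_iff (TopologicalSpace.countable_countableBasis _)).2 fun V hV =>
      eventually_imp_distrib_left.2 fun ⟨hne, hpos⟩ => ?_
    have hVo := TopologicalSpace.isOpen_of_mem_countableBasis hV
    exact ae_exists_mem_of_measure_ne_zero hX hind hVo.measurableSet
      (hf.densityLaw_ne_zero hVo hne hpos)
  filter_upwards [hbasis] with ω hω V hV ⟨x, hx⟩ hpos
  obtain ⟨W, hW, hxW, hWV⟩ :=
    (TopologicalSpace.isBasis_countableBasis (Space d)).exists_subset_of_mem_open hx hV
  obtain ⟨i, hi⟩ := hω W hW ⟨⟨x, hxW⟩, fun y hy => hpos y (hWV hy)⟩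
  exact ⟨i, hWV hi⟩

end Density

section Smoothing

variable {d : ℕ} {K f g : Space d → ℝ} {h a c r B : ℝ} {x : Space d}

/-- The kernel `K_h(z) = h^{-d} K(z / h)` at bandwidth `h`. -/
noncomputable def scaledKernel (K : Space d → ℝ) (h : ℝ) (z : Space d) : ℝ :=
  (h ^ d)⁻¹ * K (h⁻¹ • z)

/-- The convolution `K_h * f`, which is the mean of the kernel density estimator when the sample
has density `f`. -/
noncomputable def kernelSmoothing (K f : Space d → ℝ) (h : ℝ) (x : Space d) : ℝ :=
  ∫ y, scaledKernel K h (x - y) * f y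

lemma kernelEstimator_eq (K : Space d → ℝ) (h : ℝ) (n : ℕ) (pts : ℕ → Space d) (x : Space d) :
    kernelEstimator K h n pts x
      = (n : ℝ)⁻¹ * ∑ i ∈ Finset.range n, scaledKernel K h (x - pts i) := by
  simp only [kernelEstimator, scaledKernel, ← Finset.mul_sum, mul_inv, mul_assoc]

lemma scaledKernel_sq (K : Space d → ℝ) (h : ℝ) (z : Space d) :
    scaledKernel K h z ^ 2 = (h ^ d)⁻¹ * scaledKernel (fun z => K z ^ 2) h z := by
  simp only [scaledKernel]
  ring

lemma abs_scaledKernel (hh : 0 < h) (z : Space d) :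
    |scaledKernel K h z| = scaledKernel (fun z => |K z|) h z := by
  rw [scaledKernel, scaledKernel, abs_mul, abs_of_pos (by positivity : 0 < (h ^ d)⁻¹)]

lemma abs_scaledKernel_le (hB : ∀ z, |K z| ≤ B) (hh : 0 < h) (z : Space d) :
    |scaledKernel K h z| ≤ B / h ^ d := by
  rw [abs_scaledKernel hh, scaledKernel, div_eq_inv_mul]
  gcongr
  exact hB _

lemma measurable_scaledKernel (hK : Measurable K) : Measurable (scaledKernel K h) :=
  (hK.comp (measurable_const_smul h⁻¹)).const_mul _

lemma integral_scaledKernel (K : Space d → ℝ) (hh : 0 < h) (x : Space d) :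
    ∫ y, scaledKernel K h (x - y) = ∫ z, K z := by
  simp only [scaledKernel]
  rw [integral_sub_left_eq_self (fun z => (h ^ d)⁻¹ * K (h⁻¹ • z)) volume x, integral_const_mul,
    Measure.integral_comp_inv_smul volume K h, finrank_euclideanSpace_fin, smul_eq_mul,
    abs_of_pos (by positivity), inv_mul_cancel_left₀ (by positivity)]

lemma integrable_scaledKernel (hK : Integrable K) (hh : 0 < h) (x : Space d) :
    Integrable fun y => scaledKernel K h (x - y) :=
  ((hK.comp_smul (inv_ne_zero hh.ne')).comp_sub_left x).const_mul _

lemma norm_le_of_scaledKernel_ne_zero {R : ℝ} (hR : ∀ z ∈ Function.support K, ‖z‖ ≤ R)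
    (hh : 0 < h) {z : Space d} (hz : scaledKernel K h z ≠ 0) : ‖z‖ ≤ R * h := by
  have := hR _ (right_ne_zero_of_mul hz)
  rwa [norm_smul, norm_inv, Real.norm_of_nonneg hh.le, inv_mul_le_iff₀ hh, mul_comm] at this

lemma tendsto_const_mul_nhdsGT_zero {R : ℝ} (hR : 0 < R) :
    Tendsto (fun h : ℝ => R * h) (nhdsWithin 0 (Ioi 0)) (nhdsWithin 0 (Ioi 0)) := by
  refine tendsto_nhdsWithin_iff.2 ⟨tendsto_nhdsWithin_of_tendsto_nhds ?_, ?_⟩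
  · simpa only [id, mul_zero] using (tendsto_id (x := nhds (0 : ℝ))).const_mul R
  · filter_upwards [self_mem_nhdsWithin] with h hh using mul_pos hR hh

lemma eventually_forall_dist_le_of_scaledKernel_ne_zero
    (hK : Bornology.IsBounded (Function.support K)) (hr : 0 < r) :
    ∀ᶠ h in nhdsWithin 0 (Ioi 0), ∀ x y, scaledKernel K h (x - y) ≠ 0 → dist x y ≤ r := by
  obtain ⟨R, hR0, hR⟩ := hK.exists_pos_norm_le
  filter_upwards [self_mem_nhdsWithin, (tendsto_nhdsWithin_iff.1
    (tendsto_const_mul_nhdsGT_zero hR0)).1.eventually_le_const hr] with h hh hRh x y hxy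
  rw [dist_eq_norm]
  exact (norm_le_of_scaledKernel_ne_zero hR hh hxy).trans hRh

lemma abs_kernelSmoothing_le (hK : Integrable K) (hh : 0 < h)
    (hg : ∀ y, scaledKernel K h (x - y) ≠ 0 → |g y| ≤ c) :
    |kernelSmoothing K g h x| ≤ c * ∫ z, |K z| := by
  rw [← integral_scaledKernel (fun z => |K z|) hh x, ← integral_const_mul, ← Real.norm_eq_abs]
  refine norm_integral_le_of_norm_le ((integrable_scaledKernel hK.abs hh x).const_mul c)
    (.of_forall fun y => ?_)
  rw [norm_mul, Real.norm_eq_abs, Real.norm_eq_abs, ← abs_scaledKernel hh, mul_comm]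
  by_cases hy : scaledKernel K h (x - y) = 0
  · simp only [hy, abs_zero, mul_zero, le_refl]
  · exact mul_le_mul_of_nonneg_right (hg y hy) (abs_nonneg _)

lemma integral_scaledKernel_sq_le (hf : IsDensity f) (hfc : ∀ y, f y ≤ c)
    (hK : Integrable fun z => K z ^ 2) (hh : 0 < h) (x : Space d) :
    ∫ y, scaledKernel K h (x - y) ^ 2 ∂densityLaw f ≤ c * (∫ z, K z ^ 2) / h ^ d := by
  have hle := (le_abs_self _).trans (abs_kernelSmoothing_le (x := x) hK hh fun y _ =>
    (abs_of_nonneg (hf.nonneg y)).trans_le (hfc y))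
  simp only [abs_sq] at hle
  rw [hf.integral_densityLaw, div_eq_inv_mul]
  simp only [scaledKernel_sq, mul_assoc, integral_const_mul]
  gcongr
  exact hle

/-- A bounded kernel with bounded support and total mass one, not necessarily nonnegative. -/
structure IsSmoothingKernel (K : Space d → ℝ) : Prop where
  measurable : Measurable K
  exists_abs_le : ∃ B, ∀ z, |K z| ≤ B
  isBounded_support : Bornology.IsBounded (Function.support K)
  integral_eq_one : ∫ z, K z = 1

namespace IsSmoothingKernel

lemma integrable (hK : IsSmoothingKernel K) : Integrable K := by
  obtain ⟨B, hB⟩ := hK.exists_abs_le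
  rw [← integrableOn_iff_integrable_of_support_subset (s := Function.support K) subset_rfl]
  exact Measure.integrableOn_of_bounded hK.isBounded_support.measure_lt_top.ne
    hK.measurable.aestronglyMeasurable (.of_forall hB)

lemma integrable_sq (hK : IsSmoothingKernel K) : Integrable fun z => K z ^ 2 := by
  obtain ⟨B, hB⟩ := hK.exists_abs_le
  simpa only [sq] using
    hK.integrable.bdd_mul hK.measurable.aestronglyMeasurable (.of_forall hB)

lemma kernelSmoothing_sub_const (hK : IsSmoothingKernel K) (hf : Integrable f) (hh : 0 < h) :
    kernelSmoothing K (fun y => f y - a) h x = kernelSmoothing K f h x - a := by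
  obtain ⟨B, hB⟩ := hK.exists_abs_le
  have hKf : Integrable fun y => scaledKernel K h (x - y) * f y :=
    hf.bdd_mul ((measurable_scaledKernel hK.measurable).comp
      (measurable_const_sub x)).aestronglyMeasurable
      (.of_forall fun y => abs_scaledKernel_le hB hh _)
  simp only [kernelSmoothing, mul_sub]
  rw [integral_sub hKf ((integrable_scaledKernel hK.integrable hh x).mul_const a),
    integral_mul_const, integral_scaledKernel K hh, hK.integral_eq_one, one_mul]

lemma abs_kernelSmoothing_sub_le (hK : IsSmoothingKernel K) (hf : Integrable f) (hh : 0 < h)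
    (hfa : ∀ y, scaledKernel K h (x - y) ≠ 0 → |f y - a| ≤ c) :
    |kernelSmoothing K f h x - a| ≤ c * ∫ z, |K z| := by
  rw [← hK.kernelSmoothing_sub_const hf hh]
  exact abs_kernelSmoothing_le hK.integrable hh hfa

lemma kernelSmoothing_le (hK : IsSmoothingKernel K) (hK0 : ∀ z, 0 ≤ K z) (hf : Integrable f)
    (hh : 0 < h) (hfa : ∀ y, scaledKernel K h (x - y) ≠ 0 → f y ≤ a) :
    kernelSmoothing K f h x ≤ a := by
  rw [← sub_nonpos, ← hK.kernelSmoothing_sub_const hf hh]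
  refine integral_nonpos fun y => ?_
  by_cases hy : scaledKernel K h (x - y) = 0
  · simp only [hy, zero_mul, Pi.zero_apply, le_refl]
  · exact mul_nonpos_of_nonneg_of_nonpos (mul_nonneg (by positivity) (hK0 _))
      (sub_nonpos.2 (hfa y hy))

lemma ae_tendsto_kernelSmoothing (hK : IsSmoothingKernel K) (hf : Integrable f) :
    ∀ᵐ x, Tendsto (fun h => kernelSmoothing K f h x) (nhdsWithin 0 (Ioi 0)) (nhds (f x)) := by
  obtain ⟨B, hB⟩ := hK.exists_abs_le
  obtain ⟨R, hR0, hR⟩ := hK.isBounded_support.exists_pos_norm_le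
  filter_upwards [IsUnifLocDoublingMeasure.ae_tendsto_average_norm_sub (volume : Measure (Space d))
    hf.locallyIntegrable 1] with x hx
  have hpos : ∀ᶠ h : ℝ in nhdsWithin 0 (Ioi 0), 0 < h := self_mem_nhdsWithin
  have havg := hx (fun _ => x) _ (tendsto_const_mul_nhdsGT_zero hR0) (hpos.mono fun h hh => by
    simpa using (mul_pos hR0 hh).le)
  have hv : 0 < volume.real (Metric.ball (0 : Space d) 1) :=
    ENNReal.toReal_pos (Metric.measure_ball_pos volume _ one_pos).ne' measure_ball_lt_top.ne
  refine tendsto_integral_smul_of_tendsto_average_norm_sub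
    (B * (R ^ d * volume.real (Metric.ball (0 : Space d) 1))) havg
    (.of_forall fun h => hf.integrableOn) ?_ (hpos.mono fun h hh y hy => ?_)
    (hpos.mono fun h hh y => ?_)
  · refine tendsto_const_nhds.congr' (hpos.mono fun h hh => ?_)
    exact ((integral_scaledKernel K hh x).trans hK.integral_eq_one).symm
  · rw [Metric.mem_closedBall', dist_eq_norm]
    exact norm_le_of_scaledKernel_ne_zero hR hh hy
  · rw [Measure.addHaar_real_closedBall volume x (mul_pos hR0 hh).le, finrank_euclideanSpace_fin]
    refine (abs_scaledKernel_le hB hh _).trans_eq ?_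
    field_simp
    ring

end IsSmoothingKernel

end Smoothing

section Bandwidth

variable {d p : ℕ} {h r : ℕ → ℝ} {κ : ℝ}

lemma summable_mul_exp_neg_of_isLittleO_log (hr : (fun n : ℕ => Real.log n) =o[atTop] r)
    (hr0 : ∀ᶠ n in atTop, 0 ≤ r n) (hκ : 0 < κ) :
    Summable fun n : ℕ => n * Real.exp (-(κ * r n)) := by
  refine Summable.of_norm_bounded_eventually_nat (Real.summable_one_div_nat_pow.2 one_lt_two) ?_
  filter_upwards [hr.bound (by positivity : 0 < κ / 3), hr0, eventually_gt_atTop 0]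
    with n hlog hn hn0
  have hn0' : (0 : ℝ) < n := by exact_mod_cast hn0
  have hexp : 3 * Real.log n ≤ κ * r n := by
    rw [Real.norm_of_nonneg hn] at hlog
    linarith [Real.le_norm_self (Real.log n)]
  calc ‖n * Real.exp (-(κ * r n))‖ = n * Real.exp (-(κ * r n)) :=
        Real.norm_of_nonneg (by positivity)
    _ ≤ n * Real.exp (-(3 * Real.log n)) := by gcongr
    _ = n * ((n : ℝ) ^ 3)⁻¹ := by
        rw [Real.exp_neg, ← Nat.cast_ofNat (R := ℝ) (n := 3), Real.exp_nat_mul, Real.exp_log hn0']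
    _ = 1 / (n : ℝ) ^ 2 := by field_simp

/-- Bandwidths for which the kernel density estimator is strongly consistent: `h n → 0+`, and the
order `n h ^ d` of the expected number of sample points within a bandwidth of a given point
dominates `log n`. -/
structure IsConsistentBandwidth (d : ℕ) (h : ℕ → ℝ) : Prop where
  tendsto_zero : Tendsto h atTop (nhdsWithin 0 (Ioi 0))
  isLittleO_log : (fun n : ℕ => Real.log n) =o[atTop] fun n => n * h n ^ d

namespace IsConsistentBandwidth

lemma eventually_pos (hh : IsConsistentBandwidth d h) : ∀ᶠ n in atTop, 0 < h n :=
  (tendsto_nhdsWithin_iff.1 hh.tendsto_zero).2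

lemma eventually_le_mul_pow (hh : IsConsistentBandwidth d h) (C : ℝ) :
    ∀ᶠ n : ℕ in atTop, C ≤ n * h n ^ d := by
  have hlog : (fun _ : ℕ => C) =o[atTop] fun n => n * h n ^ d :=
    (Real.isLittleO_const_log_atTop.comp_tendsto tendsto_natCast_atTop_atTop).trans
      hh.isLittleO_log
  filter_upwards [hlog.bound one_pos, hh.eventually_pos] with n hn hpos
  have hpow : 0 ≤ n * h n ^ d := by positivity
  rw [one_mul, Real.norm_of_nonneg hpow] at hn
  exact (Real.le_norm_self C).trans hn

lemma summable_mul_exp_neg (hh : IsConsistentBandwidth d h) (hκ : 0 < κ) :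
    Summable fun n : ℕ => n * Real.exp (-(κ * (n * h n ^ d))) :=
  summable_mul_exp_neg_of_isLittleO_log hh.isLittleO_log (hh.eventually_le_mul_pow 0) hκ

end IsConsistentBandwidth

lemma tendsto_log_div_self_rpow {e : ℝ} (he : 0 < e) :
    Tendsto (fun n : ℕ => (Real.log n / n) ^ e) atTop (nhds 0) := by
  have hlog : Tendsto (fun x : ℝ => Real.log x / x) atTop (nhds 0) :=
    Real.isLittleO_log_id_atTop.tendsto_div_nhds_zero
  simpa only [Real.zero_rpow he.ne', Function.comp_apply] using
    (hlog.comp tendsto_natCast_atTop_atTop).rpow_const (p := e) (.inr he.le)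

lemma tendsto_thresholdShift (hp : 1 ≤ p) (M : ℝ) :
    Tendsto (thresholdShift d p M) atTop (nhds 0) := by
  have hexp : 0 < (p : ℝ) / (d + 2 * p) := by positivity
  have := (tendsto_log_div_self_rpow hexp).const_mul M
  rwa [mul_zero] at this

lemma IsAdmissibleBandwidth.isConsistentBandwidth (hh : IsAdmissibleBandwidth d p h)
    (hp : 1 ≤ p) : IsConsistentBandwidth d h := by
  set e : ℝ := 1 / ((d : ℝ) + 2 * p) with he
  have he0 : 0 < e := by positivity
  have hed : 0 < 1 - e * d := by
    have : (0 : ℝ) < p := by exact_mod_cast hp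
    rw [he, sub_pos, div_mul_eq_mul_div, one_mul, div_lt_one (by positivity)]
    linarith
  refine ⟨tendsto_nhdsWithin_iff.2
    ⟨hh.2.isBigO.trans_tendsto (tendsto_log_div_self_rpow he0), hh.1⟩, ?_⟩
  have hpow := (Asymptotics.isBigO_refl (fun n : ℕ => (n : ℝ)) atTop).mul
    (hh.2.isBigO_symm.pow d)
  have hrest := (Asymptotics.isLittleO_one_iff ℝ).2 (tendsto_log_div_self_rpow hed)
  refine (hpow.mul_isLittleO hrest).congr' ?_ (.of_forall fun n => mul_one _)
  filter_upwards [eventually_gt_atTop 1] with n hn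
  have hn1 : (1 : ℝ) < n := by exact_mod_cast hn
  have hrate : 0 < Real.log n / n := div_pos (Real.log_pos hn1) (by positivity)
  rw [← Real.rpow_mul_natCast hrate.le, mul_assoc, ← Real.rpow_add hrate, add_sub_cancel,
    Real.rpow_one, mul_div_cancel₀ _ (by positivity)]

end Bandwidth

section Concentration

variable {d : ℕ} {f K : Space d → ℝ} {B F c s δ : ℝ} {Ω : Type*} [MeasurableSpace Ω]
  {P : Measure Ω} [IsProbabilityMeasure P] {X : ℕ → Ω → Space d}

lemma abs_kernelSmoothing_le_div (hf : IsDensity f) (hB : ∀ z, |K z| ≤ B) (hs : 0 < s)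
    (x : Space d) : |kernelSmoothing K f s x| ≤ B / s ^ d := by
  have := hf.isProbabilityMeasure_densityLaw
  rw [kernelSmoothing, ← hf.integral_densityLaw, ← Real.norm_eq_abs]
  exact (norm_integral_le_of_norm_le_const
    (.of_forall fun y => abs_scaledKernel_le hB hs _)).trans_eq (by simp)

lemma mul_abs_kernelEstimator_sub_le {b m : ℝ} (hb : ∀ z, |scaledKernel K s z| ≤ b)
    (hm : |m| ≤ b) {n i : ℕ} (hi : i < n) (pts : ℕ → Space d) (x : Space d) :
    n * |kernelEstimator K s n pts x - m|
      ≤ |∑ j ∈ (Finset.range n).erase i, (scaledKernel K s (x - pts j) - m)| + 2 * b := by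
  have hn : (0 : ℝ) < n := by exact_mod_cast hi.pos
  have hsum : n * (kernelEstimator K s n pts x - m)
      = ∑ j ∈ (Finset.range n).erase i, (scaledKernel K s (x - pts j) - m)
        + (scaledKernel K s (x - pts i) - m) := by
    rw [Finset.sum_erase_add _ _ (Finset.mem_range.2 hi), kernelEstimator_eq, mul_sub,
      mul_inv_cancel_left₀ hn.ne', Finset.sum_sub_distrib, Finset.sum_const, Finset.card_range,
      nsmul_eq_mul]
  rw [← Nat.abs_cast n, ← abs_mul, hsum]
  refine (abs_add_le _ _).trans (add_le_add_right ((abs_sub _ _).trans ?_) _)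
  linarith [hb (x - pts i)]

/-- A Bernstein-type bound at a sample point: the tail bound for the other terms of the estimator
holds conditionally on `X i`, and the term `j = i` is absorbed by the lower bound on `n * s ^ d`. -/
lemma measureReal_abs_kernelEstimator_sub_ge_le (hf : IsDensity f) (hF : ∀ x, f x ≤ F)
    (hK : IsSmoothingKernel K) (hB : ∀ z, |K z| ≤ B) (hX : ∀ i, HasLaw (X i) (densityLaw f) P)
    (hind : iIndepFun X P) (hc : 0 ≤ c) (hcB : c * B ≤ 1)
    (hcF : c * (F * ∫ z, K z ^ 2) ≤ δ / 4) (hs : 0 < s) {n i : ℕ} (hi : i < n)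
    (hns : 4 * B ≤ n * s ^ d * δ) :
    P.real {ω | δ ≤ |kernelEstimator K s n (fun j => X j ω) (X i ω)
      - kernelSmoothing K f s (X i ω)|} ≤ 2 * Real.exp (-(c * δ / 4 * (n * s ^ d))) := by
  set V := F * ∫ z, K z ^ 2
  set S := (Finset.range n).erase i
  have hsd : 0 < s ^ d := by positivity
  have hown : 2 * (B / s ^ d) ≤ n * (δ / 2) := by
    rw [← mul_div_assoc, div_le_iff₀ hsd]
    linarith
  have htail := measureReal_abs_sum_sub_integral_sample_ge_le hX hind
    (φ := fun x y => scaledKernel K s (x - y)) (c := c * s ^ d) (B := B / s ^ d) (V := V / s ^ d)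
    ((measurable_scaledKernel hK.measurable).comp measurable_sub)
    (fun x y => abs_scaledKernel_le hB hs _)
    (integral_scaledKernel_sq_le hf hF hK.integrable_sq hs) (by positivity)
    (by field_simp; exact hcB) (Finset.notMem_erase i (Finset.range n)) (n * (δ / 2))
  simp only [hf.integral_densityLaw] at htail
  refine (measureReal_mono fun ω (hω : δ ≤ _) => mem_ofPred.2 ?_).trans (htail.trans ?_)
  · have hsplit := mul_abs_kernelEstimator_sub_le (abs_scaledKernel_le hB hs)
      (abs_kernelSmoothing_le_div hf hB hs (X i ω)) hi (fun j => X j ω) (X i ω)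
    have hmul := mul_le_mul_of_nonneg_left hω (n.cast_nonneg (α := ℝ))
    unfold kernelSmoothing at hsplit hmul
    linarith
  · have hS : (S.card : ℝ) ≤ n := by
      exact_mod_cast Finset.card_erase_le.trans_eq (Finset.card_range n)
    have hF0 : 0 ≤ F := (hf.nonneg 0).trans (hF 0)
    have hδ : 0 ≤ δ / 4 := le_trans (by positivity) hcF
    gcongr
    calc -(c * s ^ d * (n * (δ / 2))) + S.card * ((c * s ^ d) ^ 2 * (V / s ^ d))
        = -(c * s ^ d * (n * (δ / 2))) + S.card * (c * s ^ d * (c * V)) := by field_simp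
      _ ≤ -(c * s ^ d * (n * (δ / 2))) + S.card * (c * s ^ d * (δ / 4)) := by gcongr
      _ ≤ -(c * s ^ d * (n * (δ / 2))) + n * (c * s ^ d * (δ / 4)) := by gcongr
      _ = -(c * δ / 4 * (n * s ^ d)) := by ring

lemma eventually_mul_le_nhdsGT_zero (A : ℝ) {r : ℝ} (hr : 0 < r) :
    ∀ᶠ c in nhdsWithin (0 : ℝ) (Ioi 0), c * A ≤ r := by
  have : Tendsto (fun c : ℝ => c * A) (nhds 0) (nhds 0) := by
    simpa only [id, zero_mul] using (tendsto_id (x := nhds (0 : ℝ))).mul_const A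
  exact (this.mono_left nhdsWithin_le_nhds).eventually_le_const hr

lemma exists_eventually_measureReal_abs_kernelEstimator_sub_ge_le (hf : IsDensity f)
    (hfb : BddAbove (range f)) (hK : IsSmoothingKernel K) (hX : ∀ i, HasLaw (X i) (densityLaw f) P)
    (hind : iIndepFun X P) {h : ℕ → ℝ} (hh : IsConsistentBandwidth d h) (hδ : 0 < δ) :
    ∃ κ > 0, ∀ᶠ n in atTop, ∀ i < n,
      P.real {ω | δ ≤ |kernelEstimator K (h n) n (fun j => X j ω) (X i ω)
        - kernelSmoothing K f (h n) (X i ω)|} ≤ 2 * Real.exp (-(κ * (n * h n ^ d))) := by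
  obtain ⟨B, hB⟩ := hK.exists_abs_le
  obtain ⟨F, hF⟩ := hfb
  obtain ⟨c, ⟨hcB, hcF⟩, hc⟩ := ((eventually_mul_le_nhdsGT_zero B one_pos).and
    (eventually_mul_le_nhdsGT_zero (F * ∫ z, K z ^ 2) (by positivity : 0 < δ / 4))).and
    self_mem_nhdsWithin |>.exists
  refine ⟨c * δ / 4, by positivity, ?_⟩
  filter_upwards [hh.eventually_pos, hh.eventually_le_mul_pow (4 * B / δ)] with n hn hnB i hi
  exact measureReal_abs_kernelEstimator_sub_ge_le hf (fun x => hF (mem_range_self x)) hK hB hX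
    hind hc.le hcB hcF hn hi ((div_le_iff₀ hδ).1 hnB)

lemma ae_eventually_forall_abs_kernelEstimator_sub_lt (hf : IsDensity f)
    (hfb : BddAbove (range f)) (hK : IsSmoothingKernel K) (hX : ∀ i, HasLaw (X i) (densityLaw f) P)
    (hind : iIndepFun X P) {h : ℕ → ℝ} (hh : IsConsistentBandwidth d h) (hδ : 0 < δ) :
    ∀ᵐ ω ∂P, ∀ᶠ n in atTop, ∀ i < n,
      |kernelEstimator K (h n) n (fun j => X j ω) (X i ω)
        - kernelSmoothing K f (h n) (X i ω)| < δ := by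
  obtain ⟨κ, hκ, htail⟩ :=
    exists_eventually_measureReal_abs_kernelEstimator_sub_ge_le hf hfb hK hX hind hh hδ
  let bad (n i : ℕ) : Set Ω := {ω | δ ≤ |kernelEstimator K (h n) n (fun j => X j ω) (X i ω)
    - kernelSmoothing K f (h n) (X i ω)|}
  have hsum : Summable fun n => P.real (⋃ i ∈ Finset.range n, bad n i) := by
    refine Summable.of_norm_bounded_eventually_nat ((hh.summable_mul_exp_neg hκ).mul_left 2) ?_
    filter_upwards [htail] with n hn
    calc ‖P.real (⋃ i ∈ Finset.range n, bad n i)‖ = P.real (⋃ i ∈ Finset.range n, bad n i) :=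
          Real.norm_of_nonneg measureReal_nonneg
      _ ≤ ∑ i ∈ Finset.range n, P.real (bad n i) := measureReal_biUnion_finset_le _ _
      _ ≤ ∑ _i ∈ Finset.range n, 2 * Real.exp (-(κ * (n * h n ^ d))) :=
          Finset.sum_le_sum fun i hi => hn i (Finset.mem_range.1 hi)
      _ = 2 * (n * Real.exp (-(κ * (n * h n ^ d)))) := by
          rw [Finset.sum_const, Finset.card_range, nsmul_eq_mul, mul_left_comm]
  have hfinite : ∑' n, P (⋃ i ∈ Finset.range n, bad n i) ≠ ⊤ := by
    simpa only [ofReal_measureReal (measure_ne_top P _)] using hsum.tsum_ofReal_ne_top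
  filter_upwards [ae_eventually_notMem hfinite] with ω hω
  filter_upwards [hω] with n hn i hi
  exact not_le.1 fun hle => hn (mem_biUnion (Finset.mem_coe.2 (Finset.mem_range.2 hi)) hle)

lemma ae_forall_eventually_abs_kernelEstimator_sub_lt (hf : IsDensity f)
    (hfb : BddAbove (range f)) (hK : IsSmoothingKernel K) (hX : ∀ i, HasLaw (X i) (densityLaw f) P)
    (hind : iIndepFun X P) {h : ℕ → ℝ} (hh : IsConsistentBandwidth d h) :
    ∀ᵐ ω ∂P, ∀ δ > 0, ∀ᶠ n in atTop, ∀ i < n,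
      |kernelEstimator K (h n) n (fun j => X j ω) (X i ω)
        - kernelSmoothing K f (h n) (X i ω)| < δ := by
  filter_upwards [ae_all_iff.2 fun k : ℕ => ae_eventually_forall_abs_kernelEstimator_sub_lt hf hfb
    hK hX hind hh (Nat.one_div_pos_of_nat (α := ℝ) (n := k))] with ω hω δ hδ
  obtain ⟨k, hk⟩ := exists_nat_one_div_lt hδ
  filter_upwards [hω k] with n hn i hi using (hn i hi).trans hk

end Concentration

section Inclusions

variable {d : ℕ} {f K : Space d → ℝ} {a b l u ε : ℝ}

lemma eventually_kernelSmoothing_add_le (hf : Integrable f) (hA : IsRegularBand f a b)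
    (hal : a < l) (hub : u < b) (hK : IsSmoothingKernel K)
    (hKf : (∀ z, 0 ≤ K z) ∨ UniformContinuousOn f (levelSet f l)ᶜ) (hε : 0 < ε) :
    ∃ δ > 0, ∀ᶠ s in nhdsWithin 0 (Ioi 0), ∀ t ∈ Icc l u, ∀ x,
      (∀ y, dist x y ≤ ε → f y < t) → kernelSmoothing K f s x + δ ≤ t := by
  obtain ⟨c, hc, hlow⟩ := hA.exists_forall_le_sub hal hub (half_pos hε)
  rcases hKf with hK0 | huc
  · refine ⟨c, hc, ?_⟩
    filter_upwards [self_mem_nhdsWithin, eventually_forall_dist_le_of_scaledKernel_ne_zero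
      hK.isBounded_support (half_pos hε)] with s hs hnear t ht x hx
    refine le_sub_iff_add_le.1 (hK.kernelSmoothing_le hK0 hf hs fun y hy => hlow t ht y ?_)
    exact fun z hz => hx z (by linarith [dist_triangle x y z, hnear x y hy])
  · obtain ⟨η, ⟨hηI, hη⟩⟩ := ((eventually_mul_le_nhdsGT_zero (∫ z, |K z|) (half_pos hc)).and
      self_mem_nhdsWithin).exists
    obtain ⟨r, hr, hclose⟩ := Metric.uniformContinuousOn_iff.1
      (hA.uniformContinuousOn_compl hal.le hub.le huc) η hη
    refine ⟨c / 2, half_pos hc, ?_⟩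
    filter_upwards [self_mem_nhdsWithin, eventually_forall_dist_le_of_scaledKernel_ne_zero
      hK.isBounded_support (lt_min hε (half_pos hr))] with s hs hnear t ht x hx
    have hfx : f x ≤ t - c := hlow t ht x fun y hy => hx y (by linarith)
    have hbelow : ∀ y, dist x y ≤ ε → y ∈ {y | u ≤ f y}ᶜ := fun y hy =>
      not_le.2 ((hx y hy).trans_le ht.2)
    have habs : |kernelSmoothing K f s x - f x| ≤ c / 2 := by
      refine (hK.abs_kernelSmoothing_sub_le hf hs fun y hy => ?_).trans hηI
      obtain ⟨hyε, hyr⟩ := le_min_iff.1 (hnear x y hy)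
      exact (hclose y (hbelow y hyε) x (hbelow x (by simpa using hε.le))
        (by rw [dist_comm]; linarith)).le
    linarith [(abs_le.1 habs).2]

lemma eventually_exists_dist_le_mem_plusSample (hf : IsDensity f) (hA : IsRegularBand f a b)
    (hal : a < l) (hub : u < b) {h D : ℕ → ℝ} (hD : Tendsto D atTop (nhds 0))
    {pts : ℕ → Space d}
    (hdense : ∀ V : Set (Space d), IsOpen V → V.Nonempty → (∀ x ∈ V, 0 < f x) → ∃ i, pts i ∈ V)
    (hmean : ∀ i, Tendsto (fun n => kernelSmoothing K f (h n) (pts i)) atTop (nhds (f (pts i))))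
    (hconc : ∀ δ > 0, ∀ᶠ n in atTop, ∀ i < n,
      |kernelEstimator K (h n) n pts (pts i) - kernelSmoothing K f (h n) (pts i)| < δ)
    (hε : 0 < ε) :
    ∀ᶠ n in atTop, ∀ t ∈ Icc l u, ∀ x ∈ levelSet f t,
      ∃ y ∈ plusSample K (h n) (D n) n pts t, dist x y ≤ ε := by
  obtain ⟨c, hc, 𝒱, h𝒱, hopen, hcover⟩ := hA.exists_finite_isOpen hal hub hε
  have hbdd : Bornology.IsBounded (levelSet f l) := hA.isBounded.subset fun x => hal.le.trans
  have hhit : ∀ V ∈ 𝒱, ∃ i, pts i ∈ V := fun V hV =>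
    hdense V (hopen V hV).1 (hopen V hV).2.1 fun x hx =>
      hf.pos_of_isBounded_levelSet hbdd ((hopen V hV).2.2 x hx)
  choose! i hi using hhit
  have hsample : ∀ᶠ n in atTop, ∀ V ∈ 𝒱,
      i V < n ∧ f (pts (i V)) - c / 4 < kernelSmoothing K f (h n) (pts (i V)) :=
    (eventually_all_finite h𝒱).2 fun V _ => (eventually_gt_atTop (i V)).and
      ((hmean (i V)).eventually_const_lt (by linarith))
  filter_upwards [hsample, hconc (c / 4) (by positivity), hD.eventually_le_const (half_pos hc)]
    with n hn hdev hDn t ht x hx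
  obtain ⟨V, hV, hxV⟩ := hcover t ht x hx
  obtain ⟨hxi, hti⟩ := hxV _ (hi V hV)
  obtain ⟨hin, hmeann⟩ := hn V hV
  refine ⟨pts (i V), ⟨⟨i V, hin, rfl⟩, ?_⟩, hxi⟩
  linarith [(abs_lt.1 (hdev (i V) hin)).1]

lemma IsSmoothingKernel.ae_forall_tendsto_kernelSmoothing_sample (hK : IsSmoothingKernel K)
    (hf : IsDensity f) {Ω : Type*} [MeasurableSpace Ω] {P : Measure Ω} {X : ℕ → Ω → Space d}
    (hX : ∀ i, HasLaw (X i) (densityLaw f) P) {h : ℕ → ℝ}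
    (hh : Tendsto h atTop (nhdsWithin 0 (Ioi 0))) :
    ∀ᵐ ω ∂P, ∀ i, Tendsto (fun n => kernelSmoothing K f (h n) (X i ω)) atTop
      (nhds (f (X i ω))) := by
  refine ae_all_iff.2 fun i => ae_of_ae_map
    (p := fun x => Tendsto (fun n => kernelSmoothing K f (h n) x) atTop (nhds (f x)))
    (hX i).aemeasurable ?_
  rw [(hX i).map_eq]
  refine (withDensity_absolutelyContinuous volume _).ae_le ?_
  filter_upwards [hK.ae_tendsto_kernelSmoothing hf.integrable] with x hx using hx.comp hh

end Inclusions

lemma IsAdmissibleKernel.isSmoothingKernel {d p : ℕ} {K : Space d → ℝ}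
    (hK : IsAdmissibleKernel K p) : IsSmoothingKernel K where
  measurable := hK.continuous.measurable
  exists_abs_le := hK.continuous.bounded_above_of_compact_support <|
    Metric.isCompact_of_isClosed_isBounded (isClosed_tsupport K) hK.bounded_support.closure
  isBounded_support := hK.bounded_support
  integral_eq_one := hK.order.1

end LevelSetEstimation

open LevelSetEstimation in
theorem corollary2p1_general {d : ℕ} {f : Space d → ℝ} (hf : IsDensity f)
    (hfb : BddAbove (range f)) {a b l u : ℝ} (hal : a < l) (hub : u < b)
    (hA : IsRegularBand f a b) {K : Space d → ℝ} (hK : IsSmoothingKernel K)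
    (hKf : (∀ z, 0 ≤ K z) ∨ UniformContinuousOn f (levelSet f l)ᶜ)
    {h : ℕ → ℝ} (hh : IsConsistentBandwidth d h) {D : ℕ → ℝ} (hD : Tendsto D atTop (nhds 0))
    {Ω : Type*} [MeasurableSpace Ω] {P : Measure Ω} [IsProbabilityMeasure P]
    {X : ℕ → Ω → Space d} (hX : ∀ i, HasLaw (X i) (densityLaw f) P) (hind : iIndepFun X P)
    {ε : ℝ} (hε : 0 < ε) :
    ∀ᵐ ω ∂P, ∀ᶠ n in atTop, (⨆ t ∈ Icc l u, Metric.hausdorffEDist (levelSet f t)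
      (plusSample K (h n) (D n) n (fun i => X i ω) t)) ≤ ENNReal.ofReal ε := by
  obtain ⟨δ, hδ, hfar⟩ := eventually_kernelSmoothing_add_le hf.integrable hA hal hub hK hKf hε
  filter_upwards [hK.ae_forall_tendsto_kernelSmoothing_sample hf hX hh.tendsto_zero,
    ae_forall_eventually_abs_kernelEstimator_sub_lt hf hfb hK hX hind hh,
    ae_forall_isOpen_exists_mem hf hX hind] with ω hmean hconc hdense
  filter_upwards [eventually_exists_dist_le_mem_plusSample hf hA hal hub hD hdense hmean hconc hε,
    hh.tendsto_zero.eventually hfar, hconc (δ / 2) (half_pos hδ),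
    hD.eventually_const_lt (by linarith : -(δ / 2) < 0)] with n hnear hfar hdev hDn
  refine iSup₂_le fun t ht => Metric.hausdorffEDist_le_of_mem_edist (fun x hx => ?_) ?_
  · obtain ⟨y, hy, hxy⟩ := hnear t ht x hx
    exact ⟨y, hy, (edist_le_ofReal hε.le).2 hxy⟩
  · rintro _ ⟨⟨i, hi, rfl⟩, hval⟩
    by_contra! hisolated
    have := hfar t ht (X i ω) fun y hy => not_le.1 fun hty =>
      (hisolated y hty).not_ge ((edist_le_ofReal hε.le).2 hy)
    linarith [(abs_lt.1 (hdev i hi)).2]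

theorem corollary2p1 {d p : ℕ} (hp : 1 ≤ p) (f : LevelSetEstimation.Space d → ℝ)
    (hf : LevelSetEstimation.IsDensity f) (l u : ℝ)
    (hA : LevelSetEstimation.RegularLevels f p l u)
    (hG : ∀ t ∈ Set.Icc l u, IsCompact (LevelSetEstimation.levelSet f t) ∧
      (LevelSetEstimation.levelSet f t).Nonempty ∧
      ¬ Convex ℝ (LevelSetEstimation.levelSet f t))
    (K : LevelSetEstimation.Space d → ℝ)
    (hK : LevelSetEstimation.IsAdmissibleKernel K p)
    (hKf : (∀ z, 0 ≤ K z) ∨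
      UniformContinuousOn f (LevelSetEstimation.levelSet f l)ᶜ)
    (h : ℕ → ℝ) (hh : LevelSetEstimation.IsAdmissibleBandwidth d p h) :
    ∃ M₀ : ℝ, 0 < M₀ ∧ ∀ M : ℝ, M₀ ≤ M →
      ∀ (Ω : Type*) [MeasurableSpace Ω] (P : Measure Ω) [IsProbabilityMeasure P]
        (X : ℕ → Ω → LevelSetEstimation.Space d),
        (∀ i, HasLaw (X i) (LevelSetEstimation.densityLaw f) P) → iIndepFun X P →
        ∀ ε : ℝ, 0 < ε →
          ∀ᵐ ω ∂P, ∀ᶠ n : ℕ in atTop,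
            (⨆ t ∈ Set.Icc l u,
              Metric.hausdorffEDist (LevelSetEstimation.levelSet f t)
                (LevelSetEstimation.plusSample K (h n)
                  (LevelSetEstimation.thresholdShift d p M n) n (fun i => X i ω) t))
              ≤ ENNReal.ofReal ε := by
  obtain ⟨ζ, hζ, hband⟩ := hA.exists_isRegularBand
  exact ⟨1, one_pos, fun M _ Ω _ P _ X hX hind ε hε =>
    corollary2p1_general hf hA.bddAbove (sub_lt_self l hζ) (lt_add_of_pos_right u hζ) hband
      hK.isSmoothingKernel hKf (hh.isConsistentBandwidth hp)
      (LevelSetEstimation.tendsto_thresholdShift hp M) hX hind hε⟩
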